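/- Let $R$ be an excellent (commutative, Noetherian) ring of characteristic $p$, where $p$ is a prime number, and let $M$ be a finite $R$-module. For an ideal $I$ of $R$ and $q=p^e$ let $I^{[q]}$ denote the ideal generated by the $q$-th powers of the elements of $I$. Then there is a constant $C$, depending only on $R$ and $M$, such that for every prime ideal $\mathfrak p$ of $R$ there is an element $s\in R\setminus\mathfrak p$ with the following property: for every prime ideal $\mathfrak q$ of $R$ with $\mathfrak p\subseteq\mathfrak q$ and $s\notin\mathfrak q$, and for all $q=p^e$ with $e\ge 0$, $$\ell_{R_{\mathfrak q}}\bigl(M_{\mathfrak q}/\mathfrak q^{[q]}M_{\mathfrak q}\bigr)\le C\,q^{\dim M_{\mathfrak q}},$$ where $\ell_{R_{\mathfrak q}}$ denotes length and $\dim M_{\mathfrak q}$ the Krull dimension of the support of $M_{\mathfrak q}$. (If $M_{\mathfrak q}=0$, the left-hand side is $0$ and the inequality is understood to hold.) -/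

import Mathlib

universe u v

namespace KeyLemma

open scoped TensorProduct

/-- A (not necessarily Noetherian) ring is catenary if, for all primes `P`, `Q`, the lengths of the
chains of primes from `P` to `Q` are bounded, and all saturated chains of primes from `P` to `Q`
have the same length. -/
structure IsCatenaryRing (A : Type u) [CommRing A] : Prop where
  bounded : ∀ P Q : PrimeSpectrum A, ∃ n : ℕ, ∀ c : LTSeries (PrimeSpectrum A),
    c.head = P → c.last = Q → c.length ≤ n
  length_eq : ∀ c c' : RelSeries {x : PrimeSpectrum A × PrimeSpectrum A | x.1 ⋖ x.2},
    c.head = c'.head → c.last = c'.last → c.length = c'.length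

/-- A Noetherian ring is universally catenary if every algebra of finite type over it is
catenary. -/
structure IsUniversallyCatenaryRing (R : Type u) [CommRing R] : Prop where
  isNoetherianRing : IsNoetherianRing R
  isCatenaryRing : ∀ (A : Type u) [CommRing A] [Algebra R A] [Algebra.FiniteType R A],
    IsCatenaryRing A

/-- An algebra `A` over a field `k` is geometrically regular if `K ⊗ₖ A` is a (Noetherian) regular
ring for every finite field extension `K` of `k`. -/
def IsGeometricallyRegular (k : Type u) (A : Type v) [Field k] [CommRing A] [Algebra k A] : Prop :=
  ∀ (K : Type u) [Field K] [Algebra k K] [FiniteDimensional k K], IsRegularRing (K ⊗[k] A)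

/-- A ring homomorphism `A → B` (given as an algebra) is regular if it is flat and all its fibres
`κ(P) ⊗_A B` are geometrically regular over `κ(P)`. -/
structure IsRegularAlgebra (A : Type u) (B : Type v) [CommRing A] [CommRing B] [Algebra A B] :
    Prop where
  flat : Module.Flat A B
  fiber : ∀ (P : Ideal A) [P.IsPrime], IsGeometricallyRegular P.ResidueField (P.Fiber B)

/-- A Noetherian ring `R` is a G-ring if, for every prime `P`, the map from the local ring `R_P`
to its completion is regular. -/
structure IsGRing (R : Type u) [CommRing R] : Prop where
  isNoetherianRing : IsNoetherianRing R
  isRegularAlgebra : ∀ (P : Ideal R) [P.IsPrime],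
    IsRegularAlgebra (Localization.AtPrime P)
      (AdicCompletion (IsLocalRing.maximalIdeal (Localization.AtPrime P))
        (Localization.AtPrime P))

/-- The set of primes `P` of `A` such that `A_P` is a regular local ring. -/
def regularLocus (A : Type u) [CommRing A] : Set (PrimeSpectrum A) :=
  {P | IsRegularLocalRing (Localization.AtPrime P.asIdeal)}

/-- A Noetherian ring is J-2 if every algebra of finite type over it has an open regular locus. -/
structure IsJ2Ring (R : Type u) [CommRing R] : Prop where
  isNoetherianRing : IsNoetherianRing R
  isOpen_regularLocus : ∀ (A : Type u) [CommRing A] [Algebra R A] [Algebra.FiniteType R A],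
    IsOpen (regularLocus A)

/-- A ring is excellent if it is Noetherian, universally catenary, a G-ring and J-2. -/
structure IsExcellentRing (R : Type u) [CommRing R] : Prop where
  isNoetherianRing : IsNoetherianRing R
  isUniversallyCatenaryRing : IsUniversallyCatenaryRing R
  isGRing : IsGRing R
  isJ2Ring : IsJ2Ring R

/-- The ideal `I^{[n]}` generated by the `n`-th powers of the elements of `I` (the Frobenius power
of `I` if `n` is a power of the characteristic). -/
def bracketPower {R : Type u} [CommRing R] (I : Ideal R) (n : ℕ) : Ideal R :=
  Ideal.span {y | ∃ x ∈ I, y = x ^ n}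

/-- The localization `M_Q` of the module `M` at the prime `Q`, a module over `R_Q`. -/
abbrev LocalizedAt {R : Type u} [CommRing R] (M : Type v) [AddCommGroup M] [Module R M]
    (Q : Ideal R) [Q.IsPrime] :=
  LocalizedModule Q.primeCompl M

/-- The length of the `R_Q`-module `M_Q / Q^{[n]} M_Q`. -/
noncomputable def bracketLength {R : Type u} [CommRing R] (M : Type v) [AddCommGroup M] [Module R M]
    (Q : Ideal R) [Q.IsPrime] (n : ℕ) : ℕ∞ :=
  Module.length (Localization.AtPrime Q)
    (LocalizedAt M Q ⧸ ((bracketPower Q n).map (algebraMap R (Localization.AtPrime Q)) •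
      (⊤ : Submodule (Localization.AtPrime Q) (LocalizedAt M Q))))

/-- The Krull dimension of the support of a module, as a natural number. For a nonzero finite module
over a Noetherian local ring the dimension is finite and this is its value; the zero module, whose
dimension is `⊥`, gets the value `0`. -/
noncomputable def moduleDim (A : Type u) [CommRing A] (N : Type v) [AddCommGroup N] [Module A N] :
    ℕ :=
  ((Module.supportDim A N).unbotD 0).toNat

theorem coe_moduleDim (A : Type u) [CommRing A] [IsLocalRing A] [IsNoetherianRing A]
    (N : Type v) [AddCommGroup N] [Module A N] [Nontrivial N] [Module.Finite A N] :
    ((moduleDim A N : ℕ∞) : WithBot ℕ∞) = Module.supportDim A N := by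
  have h1 : Module.supportDim A N ≠ ⊥ := Module.supportDim_ne_bot_of_nontrivial A N
  have h2 : Module.supportDim A N ≠ ⊤ := by
    have := Module.supportDim_le_ringKrullDim A N
    have h3 : ringKrullDim A < ⊤ := ringKrullDim_lt_top
    exact (this.trans_lt h3).ne
  unfold moduleDim
  generalize Module.supportDim A N = d at *
  induction d with
  | bot => exact absurd rfl h1
  | coe d =>
    have : d ≠ ⊤ := fun h => h2 (by rw [h]; rfl)
    rw [WithBot.unbotD_coe, ENat.natCast_toNat this]

end KeyLemma

/-!
The bound holds with one constant `C` at all primes `Q` of `R` at once, so that `s = 1` will do. By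
Noetherian induction on closed subsets of `Spec R`, it is enough to find, for every prime `P`, a
constant that works for all `Q` in a neighbourhood of `P` in `V(P)`
(`KeyLemma.exists_bracketLength_le_of_isOpen_regularLocus`). If `M_P = 0`, then `M_Q = 0` nearby.

Otherwise let `x₁, …, x_d ∈ P` be a system of parameters of `M_P`, `d = dim M_P`. Let `z₁, …, z_c`
generate `P`; near `P`, some power `z_iᵏ` of each of them lies in `(x) + Ann M`. As `R` is J-2, the ring
`(R / P)_Q` is regular for `Q` near `P` in `V(P)`, so that `Q R_Q` is generated by `z` and
`h = ht (Q / P)` elements `y₁, …, y_h`. Replacing one of the elements by its `n`-th power multiplies the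
length of the quotient by at most `n`
(`Submodule.length_quotient_iSup_pow_smul_top_sup_le`), hence
`ℓ (M_Q / Q^[n] M_Q) ≤ ℓ (M_Q / (xⁿ, yⁿ) M_Q) ≤ n ^ (d + h) * ℓ (M_Q / (x, y) M_Q)` and
`ℓ (M_Q / (x, y) M_Q) ≤ ℓ (M_Q / (zᵏ, y) M_Q) ≤ kᶜ * ℓ (M_Q / Q M_Q) ≤ kᶜ * m`,
where `m` is the number of generators of `M` (`KeyLemma.bracketLength_le_mul`). The factor `kᶜ * m` does
not depend on `Q`, and `d + h ≤ dim M_Q`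
(`Ideal.height_quotient_add_height_quotient_le_supportDim`).
-/

section

open scoped Pointwise

/-! ### Lengths of quotients by powers of elements -/

section

variable {A : Type*} [CommRing A] {N : Type*} [AddCommGroup N] [Module A N]

/-- Length is subadditive along a right exact sequence. -/
theorem Module.length_le_add_of_exact {L N P : Type*} [AddCommGroup L] [Module A L]
    [AddCommGroup N] [Module A N] [AddCommGroup P] [Module A P]
    (f : L →ₗ[A] N) (g : N →ₗ[A] P) (h : Function.Exact f g)
    (hg : Function.Surjective g) :
    Module.length A N ≤ Module.length A L + Module.length A P := by
  rw [Module.length_eq_add_of_exact (LinearMap.range f).subtype g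
    (Submodule.subtype_injective _) hg (LinearMap.exact_iff.mpr (by
      rw [Submodule.range_subtype, LinearMap.exact_iff.mp h]))]
  gcongr
  exact Module.length_le_of_surjective f.rangeRestrict f.surjective_rangeRestrict

theorem Submodule.length_quotient_anti {K K' : Submodule A N} (h : K ≤ K') :
    Module.length A (N ⧸ K') ≤ Module.length A (N ⧸ K) :=
  Module.length_le_of_surjective (Submodule.factor h) (Submodule.factor_surjective h)

/-- By induction on `n`: multiplication by `a` maps `N / (aⁿN + K)` onto the kernel of
`N / (aⁿ⁺¹N + K) → N / (aN + K)`. -/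
theorem Submodule.length_quotient_pow_smul_top_sup_le (a : A) (K : Submodule A N) (n : ℕ) :
    Module.length A (N ⧸ (a ^ n • (⊤ : Submodule A N) ⊔ K)) ≤
      n * Module.length A (N ⧸ (a • (⊤ : Submodule A N) ⊔ K)) := by
  induction n with
  | zero =>
    have : Subsingleton (N ⧸ (a ^ 0 • (⊤ : Submodule A N) ⊔ K)) := by
      rw [Submodule.Quotient.subsingleton_iff]; simp
    simp [Module.length_eq_zero]
  | succ n ih =>
    have hle : a ^ n • (⊤ : Submodule A N) ⊔ K ≤
        (a ^ (n + 1) • (⊤ : Submodule A N) ⊔ K).comap (LinearMap.lsmul A N a) := by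
      refine sup_le ?_ fun x hx => ?_
      · rintro _ ⟨y, -, rfl⟩
        refine Submodule.mem_sup_left ⟨y, trivial, ?_⟩
        change a ^ (n + 1) • y = a • a ^ n • y
        rw [pow_succ', mul_smul]
      · exact Submodule.mem_sup_right (K.smul_mem a hx)
    have hle' : a ^ (n + 1) • (⊤ : Submodule A N) ⊔ K ≤ a • (⊤ : Submodule A N) ⊔ K := by
      refine sup_le_sup_right ?_ K
      rintro _ ⟨y, -, rfl⟩
      exact ⟨a ^ n • y, trivial, by
        change a • a ^ n • y = a ^ (n + 1) • y
        rw [pow_succ', mul_smul]⟩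
    refine (Module.length_le_add_of_exact (Submodule.mapQ _ _ (LinearMap.lsmul A N a) hle)
      (Submodule.factor hle') ?_ (Submodule.factor_surjective hle')).trans ?_
    · intro x
      obtain ⟨x, rfl⟩ := Submodule.Quotient.mk_surjective _ x
      constructor
      · intro hx
        change Submodule.Quotient.mk x = 0 at hx
        rw [Submodule.Quotient.mk_eq_zero, Submodule.mem_sup] at hx
        obtain ⟨_, ⟨y, -, rfl⟩, z, hz, rfl⟩ := hx
        refine ⟨Submodule.Quotient.mk y, ?_⟩
        rw [Submodule.mapQ_apply, Submodule.Quotient.eq]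
        refine Submodule.mem_sup_right ?_
        simpa using hz
      · rintro ⟨y, hy⟩
        obtain ⟨y, rfl⟩ := Submodule.Quotient.mk_surjective _ y
        rw [← hy, Submodule.mapQ_apply]
        refine (Submodule.Quotient.mk_eq_zero _).mpr ?_
        exact Submodule.mem_sup_left ⟨y, trivial, rfl⟩
    · rw [Nat.cast_succ, add_one_mul]
      gcongr

/-- Replacing `r` elements by their `n`-th powers multiplies the colength by at most `n ^ r`. No
finiteness is needed: the lengths may be infinite. -/
theorem Submodule.length_quotient_iSup_pow_smul_top_sup_le {ι : Type*} (x : ι → A) (s : Finset ι)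
    (K : Submodule A N) (n : ℕ) :
    Module.length A (N ⧸ ((⨆ i ∈ s, x i ^ n • (⊤ : Submodule A N)) ⊔ K)) ≤
      (n ^ s.card : ℕ) * Module.length A (N ⧸ ((⨆ i ∈ s, x i • (⊤ : Submodule A N)) ⊔ K)) := by
  classical
  induction s using Finset.induction_on generalizing K with
  | empty =>
    rw [Finset.card_empty, pow_zero, Nat.cast_one, one_mul]
    exact Submodule.length_quotient_anti (by simp)
  | insert i s hi ih =>
    rw [Finset.iSup_insert, Finset.iSup_insert, sup_assoc, Finset.card_insert_of_notMem hi,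
      pow_succ']
    refine (Submodule.length_quotient_pow_smul_top_sup_le _ _ n).trans ?_
    rw [Nat.cast_mul, mul_assoc, sup_left_comm, sup_assoc, sup_left_comm (x i • ⊤)]
    gcongr
    exact ih _

/-- The easy half of Nakayama's lemma: `N / 𝔪N` has length at most the number of generators of `N`. -/
theorem Submodule.length_quotient_maximalIdeal_smul_top_le [IsLocalRing A] {n : ℕ} (g : Fin n → N)
    (hg : Submodule.span A (Set.range g) = ⊤) :
    Module.length A (N ⧸ (IsLocalRing.maximalIdeal A • (⊤ : Submodule A N))) ≤ n := by
  set m := IsLocalRing.maximalIdeal A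
  let f (i : Fin n) : (A ⧸ m) →ₗ[A] N ⧸ (m • (⊤ : Submodule A N)) :=
    Submodule.liftQ m (LinearMap.toSpanSingleton A _ (Submodule.Quotient.mk (g i))) fun a ha => by
      rw [LinearMap.mem_ker, LinearMap.toSpanSingleton_apply, ← Submodule.Quotient.mk_smul,
        Submodule.Quotient.mk_eq_zero]
      exact Submodule.smul_mem_smul ha trivial
  have hf : Function.Surjective (LinearMap.lsum A (fun _ : Fin n => A ⧸ m) ℕ f) := by
    rw [← LinearMap.range_eq_top, ← top_le_iff, ← Submodule.range_mkQ, ← Submodule.map_top]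
    refine (Submodule.map_mono hg.ge).trans ((Submodule.map_span_le _ _ _).mpr ?_)
    rintro _ ⟨i, rfl⟩
    refine ⟨Pi.single i (Submodule.Quotient.mk 1), ?_⟩
    rw [LinearMap.lsum_piSingle]
    exact congrArg _ (one_smul A (g i))
  refine (Module.length_le_of_surjective _ hf).trans ?_
  have : IsSimpleModule A (A ⧸ m) := by
    rw [isSimpleModule_iff_isCoatom]
    exact Ideal.IsMaximal.out
  rw [Module.length_pi_of_fintype]
  simp [Module.length_eq_one]

end

section

variable {R : Type*} [CommRing R]

/-! ### Chains of primes in the support -/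

theorem PrimeSpectrum.strictMono_comap_of_surjective {S : Type*} [CommRing S] {f : R →+* S}
    (hf : Function.Surjective f) : StrictMono (PrimeSpectrum.comap f) :=
  Monotone.strictMono_of_injective (fun _ _ h => Ideal.comap_mono h)
    (PrimeSpectrum.comap_injective_of_surjective f hf)

/-- Chains of primes of `Supp M` ending in `P` and chains from `P` to `Q` can be joined, so
`dim M_P + ht (Q / P) ≤ dim M_Q`. Here `P'` and `Q'` are `P` and `Q` as primes of `R / Ann M` and
`R / P`, so that `dim M_P` is the height of `P'`. -/
theorem Ideal.height_quotient_add_height_quotient_le_supportDim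
    (M : Type*) [AddCommGroup M] [Module R M] [Module.Finite R M] (P Q : Ideal R)
    [P.IsPrime] [Q.IsPrime] (hPQ : P ≤ Q) (P' : Ideal (R ⧸ Module.annihilator R M)) [P'.IsPrime]
    (hP' : P'.comap (Ideal.Quotient.mk _) = P) (Q' : Ideal (R ⧸ P)) [Q'.IsPrime]
    (hQ' : Q'.comap (Ideal.Quotient.mk _) = Q) :
    ((P'.height + Q'.height : ℕ∞) : WithBot ℕ∞) ≤
      Module.supportDim (Localization.AtPrime Q) (LocalizedModule Q.primeCompl M) := by
  have hP : Module.annihilator R M ≤ P := by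
    intro a ha
    rw [← hP', Ideal.mem_comap, Ideal.Quotient.eq_zero_iff_mem.mpr ha]
    exact P'.zero_mem
  -- `S` is the part of the support of `M` below `Q`, which is the support of `M_Q`.
  let S := {p : PrimeSpectrum R // Module.annihilator R M ≤ p.asIdeal ∧ p.asIdeal ≤ Q}
  let x : S := ⟨⟨P, inferInstance⟩, hP, hPQ⟩
  have : Nonempty S := ⟨x⟩
  have h1 : P'.height ≤ Order.height x := by
    have h := PrimeSpectrum.height_eq_orderHeight ⟨P', inferInstance⟩
    rw [h, ← WithBot.coe_le_coe, Order.height_eq_krullDim_Iic, Order.height_eq_krullDim_Iic]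
    refine Order.krullDim_le_of_strictMono (fun p => ⟨⟨p.1.comap (Ideal.Quotient.mk _), ?_, ?_⟩, ?_⟩)
      fun p p' hp => PrimeSpectrum.strictMono_comap_of_surjective Ideal.Quotient.mk_surjective hp
    · intro a ha
      change Ideal.Quotient.mk _ a ∈ p.1.asIdeal
      rw [Ideal.Quotient.eq_zero_iff_mem.mpr ha]
      exact p.1.asIdeal.zero_mem
    · exact ((Ideal.comap_mono p.2).trans hP'.le).trans hPQ
    · exact (Ideal.comap_mono p.2).trans hP'.le
  have h2 : Q'.height ≤ Order.coheight x := by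
    have h := PrimeSpectrum.height_eq_orderHeight ⟨Q', inferInstance⟩
    rw [h, ← WithBot.coe_le_coe, Order.height_eq_krullDim_Iic, Order.coheight_eq_krullDim_Ici]
    have hle (p : PrimeSpectrum (R ⧸ P)) : P ≤ (p.comap (Ideal.Quotient.mk P)).asIdeal := by
      intro a ha
      change Ideal.Quotient.mk _ a ∈ p.asIdeal
      rw [Ideal.Quotient.eq_zero_iff_mem.mpr ha]
      exact p.asIdeal.zero_mem
    exact Order.krullDim_le_of_strictMono
      (fun p => ⟨⟨p.1.comap (Ideal.Quotient.mk _), hP.trans (hle p.1),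
        (Ideal.comap_mono p.2).trans hQ'.le⟩, hle p.1⟩)
      fun p p' hp => PrimeSpectrum.strictMono_comap_of_surjective Ideal.Quotient.mk_surjective hp
  have h3 : Order.krullDim S ≤
      Module.supportDim (Localization.AtPrime Q) (LocalizedModule Q.primeCompl M) := by
    let e := IsLocalization.AtPrime.primeSpectrumOrderIso (Localization.AtPrime Q) Q
    refine Order.krullDim_le_of_strictMono (fun p => ⟨e.symm ⟨p.1, p.2.2⟩, ?_⟩)
      fun p p' hp => e.symm.strictMono hp
    have hp : (e.symm ⟨p.1, p.2.2⟩).asIdeal.comap (algebraMap R (Localization.AtPrime Q)) =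
        p.1.asIdeal :=
      congrArg (fun p => p.1.asIdeal) (e.apply_symm_apply ⟨p.1, p.2.2⟩)
    have hpM : p.1 ∈ Module.support R M := by
      rw [Module.support_eq_zeroLocus]
      exact p.2.1
    rw [Module.mem_support_iff'] at hpM ⊢
    obtain ⟨m, hm⟩ := hpM
    refine ⟨LocalizedModule.mk m 1, fun r hr h0 => ?_⟩
    obtain ⟨a, t, rfl⟩ := IsLocalization.exists_mk'_eq Q.primeCompl r
    have h1 : a • LocalizedModule.mk (S := Q.primeCompl) m 1 = 0 := by
      rw [← algebraMap_smul (Localization.AtPrime Q) a,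
        ← IsLocalization.mk'_spec' (Localization.AtPrime Q) a t, mul_smul, h0, smul_zero]
    rw [LocalizedModule.smul'_mk, ← LocalizedModule.zero_mk 1, LocalizedModule.mk_eq] at h1
    obtain ⟨u, hu⟩ := h1
    have ha : a ∉ p.1.asIdeal := by
      rw [← hp]
      exact fun h => hr (IsLocalization.mk'_mem_iff.mpr h)
    refine hm (u * a) ?_ (by simpa [mul_smul, Submonoid.smul_def] using hu)
    exact fun h => (p.1.isPrime.mem_or_mem h).elim (fun h => u.2 (p.2.2 h)) ha
  refine le_trans ?_ h3
  rw [Order.krullDim_eq_iSup_height_add_coheight_of_nonempty, WithBot.coe_le_coe]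
  exact (add_le_add h1 h2).trans (le_iSup (fun a : S => Order.height a + Order.coheight a) x)

/-! ### Parameters and generators near a prime -/

theorem Ideal.exists_mul_pow_mem_of_mem_minimalPrimes [IsNoetherianRing R] {I p : Ideal R}
    (hp : p ∈ I.minimalPrimes) (Z : Finset R) (hZ : ∀ z ∈ Z, z ∈ p) :
    ∃ k, ∃ s ∉ p, ∀ z ∈ Z, s * z ^ k ∈ I := by
  classical
  have := hp.isPrime
  have hrad := IsLocalization.AtPrime.radical_map_of_mem_minimalPrimes
    (A := Localization.AtPrime p) p I hp
  obtain ⟨k, hk⟩ := Ideal.exists_radical_pow_le_of_fg (I.map (algebraMap R (Localization.AtPrime p)))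
    (IsNoetherian.noetherian _)
  rw [hrad] at hk
  have h (z : R) : ∃ s ∉ p, z ∈ Z → s * z ^ k ∈ I := by
    by_cases hz : z ∈ Z
    · have hmem := hk (Ideal.pow_mem_pow (Ideal.mem_map_of_mem _ (hZ z hz)) k)
      rw [← map_pow, IsLocalization.algebraMap_mem_map_algebraMap_iff p.primeCompl] at hmem
      obtain ⟨s, hs, hs'⟩ := hmem
      exact ⟨s, hs, fun _ => hs'⟩
    · exact ⟨1, p.ne_top_iff_one.mp hp.isPrime.ne_top, fun h => absurd h hz⟩
  choose s hs hs' using h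
  refine ⟨k, ∏ z ∈ Z, s z, ?_, fun z hz => ?_⟩
  · rw [hp.isPrime.prod_mem_iff]
    rintro ⟨z, -, hz⟩
    exact hs z hz
  · rw [← Finset.mul_prod_erase Z s hz, mul_right_comm]
    exact I.mul_mem_right _ (hs' z hz)

/-- If `I = Ann M`, the elements of `s` form a system of parameters of `M_P`: there are
`ht (P / I) = dim M_P` of them, and `P` is minimal over `I` and lifts of them. -/
theorem Ideal.exists_finset_mem_minimalPrimes_comap_quotient [IsNoetherianRing R] {I P : Ideal R}
    [P.IsPrime] (hP : I ≤ P) :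
    ∃ (P' : Ideal (R ⧸ I)) (_ : P'.IsPrime) (s : Finset (R ⧸ I)),
      P'.comap (Ideal.Quotient.mk I) = P ∧ (s.card : ℕ∞) = P'.height ∧
      P ∈ ((Ideal.span (s : Set (R ⧸ I))).comap (Ideal.Quotient.mk I)).minimalPrimes := by
  have := Ideal.isPrime_map_quotientMk_of_isPrime hP
  obtain ⟨s, hs, hcard⟩ :=
    (P.map (Ideal.Quotient.mk I)).exists_finset_card_eq_height_of_isNoetherianRing
  have hc : (P.map (Ideal.Quotient.mk I)).comap (Ideal.Quotient.mk I) = P := by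
    rw [Ideal.comap_map_of_surjective' _ Ideal.Quotient.mk_surjective, Ideal.mk_ker,
      sup_eq_left.mpr hP]
  refine ⟨_, this, s, hc, hcard, ?_⟩
  rw [Ideal.comap_minimalPrimes_eq_of_surjective Ideal.Quotient.mk_surjective]
  exact ⟨_, hs, hc⟩

theorem IsRegularLocalRing.localization_atPrime_bot [IsDomain R] :
    IsRegularLocalRing (Localization.AtPrime (⊥ : Ideal R)) := by
  have : IsFractionRing R (Localization.AtPrime (⊥ : Ideal R)) := by
    simpa [Ideal.primeCompl_bot] using Localization.isLocalization (M := (⊥ : Ideal R).primeCompl)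
  let : Field (Localization.AtPrime (⊥ : Ideal R)) := IsFractionRing.toField R
  infer_instance

/-- If `(R / P)_Q` is regular, then, locally at `Q`, the ideal `Q` is generated by `P` and `ht (Q / P)`
elements of `Q`. The elements are lifts `y i` of a minimal system of generators `i ∈ s` of the maximal
ideal of `(R / P)_Q`, after denominators have been cleared. -/
theorem IsRegularLocalRing.exists_finset_forall_mul_mem_span_sup {P Q : Ideal R}
    [P.IsPrime] (Q' : Ideal (R ⧸ P)) [Q'.IsPrime] (hQ' : Q'.comap (Ideal.Quotient.mk P) = Q)
    [hreg : IsRegularLocalRing (Localization.AtPrime Q')] :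
    ∃ (s : Finset (Localization.AtPrime Q')) (y : Localization.AtPrime Q' → R),
      (s.card : ℕ∞) = Q'.height ∧ (∀ i ∈ s, y i ∈ Q) ∧
      ∀ a ∈ Q, ∃ t ∉ Q, t * a ∈ Ideal.span (y '' s) ⊔ P := by
  set B := Localization.AtPrime Q'
  have hfg : Submodule.FG (IsLocalRing.maximalIdeal B) := IsNoetherian.noetherian _
  have hfin := hfg.finite_generators
  have h (g : B) : ∃ y : R, ∃ t ∉ Q', g * algebraMap (R ⧸ P) B t =
      algebraMap (R ⧸ P) B (Ideal.Quotient.mk P y) := by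
    obtain ⟨⟨a, t⟩, h⟩ := IsLocalization.surj Q'.primeCompl g
    obtain ⟨y, rfl⟩ := Ideal.Quotient.mk_surjective a
    exact ⟨y, t, t.2, h⟩
  choose y t ht hy using h
  refine ⟨hfin.toFinset, y, ?_, ?_, ?_⟩
  · rw [← Set.ncard_eq_toFinset_card (hs := hfin), hfg.generators_ncard, ← WithBot.coe_inj,
      ← IsLocalization.AtPrime.ringKrullDim_eq_height Q' B, ← hreg.spanFinrank_maximalIdeal]
    rfl
  · intro g hg
    rw [← hQ', Ideal.mem_comap, ← IsLocalization.AtPrime.to_map_mem_maximal_iff B Q', ← hy]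
    rw [Set.Finite.mem_toFinset] at hg
    refine Ideal.mul_mem_right _ _ ?_
    rw [← Submodule.span_generators (IsLocalRing.maximalIdeal B)]
    exact Submodule.subset_span hg
  · intro a ha
    rw [Set.Finite.coe_toFinset]
    have ha' : algebraMap (R ⧸ P) B (Ideal.Quotient.mk P a) ∈
        ((Ideal.span (y '' Submodule.generators (IsLocalRing.maximalIdeal B))).map
          (Ideal.Quotient.mk P)).map (algebraMap (R ⧸ P) B) := by
      have hle : IsLocalRing.maximalIdeal B ≤ ((Ideal.span
          (y '' Submodule.generators (IsLocalRing.maximalIdeal B))).map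
          (Ideal.Quotient.mk P)).map (algebraMap (R ⧸ P) B) := by
        conv_lhs => rw [← Submodule.span_generators (IsLocalRing.maximalIdeal B)]
        refine Ideal.span_le.mpr fun g hg => ?_
        have hu : IsUnit (algebraMap (R ⧸ P) B (t g)) :=
          IsLocalization.map_units B (⟨t g, ht g⟩ : Q'.primeCompl)
        rw [SetLike.mem_coe, ← Ideal.mul_unit_mem_iff_mem _ hu, hy]
        exact Ideal.mem_map_of_mem _ (Ideal.mem_map_of_mem _
          (Ideal.subset_span (Set.mem_image_of_mem y hg)))
      refine hle ?_
      rw [IsLocalization.AtPrime.to_map_mem_maximal_iff B Q']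
      rwa [← hQ'] at ha
    rw [IsLocalization.algebraMap_mem_map_algebraMap_iff Q'.primeCompl] at ha'
    obtain ⟨u, hu, hua⟩ := ha'
    obtain ⟨u, rfl⟩ := Ideal.Quotient.mk_surjective u
    refine ⟨u, by rw [← hQ']; exact hu, ?_⟩
    rwa [← map_mul, ← Ideal.mem_comap,
      Ideal.comap_map_of_surjective' _ Ideal.Quotient.mk_surjective, Ideal.mk_ker] at hua

theorem Submodule.smul_mem_of_mul_mem {A N : Type*} [CommRing A] [Algebra R A] [AddCommGroup N]
    [Module A N] (W : Submodule A N) {J : Ideal R}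
    (hJ : ∀ j ∈ J, ∀ n : N, algebraMap R A j • n ∈ W) {t r : R} (ht : IsUnit (algebraMap R A t))
    (h : t * r ∈ J) (n : N) : algebraMap R A r • n ∈ W := by
  obtain ⟨u, hu⟩ := ht
  have := W.smul_mem (↑u⁻¹ : A) (hJ _ h n)
  rwa [map_mul, ← hu, smul_smul, Units.inv_mul_cancel_left] at this

theorem Submodule.iSup_smul_top_le_iff {A N ι : Type*} [CommRing A] [AddCommGroup N]
    [Module A N] (W : Submodule A N) (s : Finset ι) (x : ι → A) :
    ⨆ i ∈ s, x i • (⊤ : Submodule A N) ≤ W ↔ ∀ i ∈ s, ∀ n : N, x i • n ∈ W := by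
  simp only [iSup_le_iff]
  refine forall₂_congr fun i _ => ⟨fun h n => h ⟨n, trivial, rfl⟩, ?_⟩
  rintro h _ ⟨n, -, rfl⟩
  exact h n

theorem Submodule.smul_mem_of_mem_span_sup {A N : Type*} [CommRing A] [Algebra R A]
    [AddCommGroup N] [Module A N] (W : Submodule A N) {S : Set R} {J : Ideal R}
    (hS : ∀ j ∈ S, ∀ n : N, algebraMap R A j • n ∈ W)
    (hJ : ∀ j ∈ J, ∀ n : N, algebraMap R A j • n ∈ W) {r : R} (hr : r ∈ Ideal.span S ⊔ J) (n : N) :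
    algebraMap R A r • n ∈ W := by
  -- The elements that multiply `N` into `W` form an ideal.
  let I : Ideal R :=
    { carrier := {r | ∀ n : N, algebraMap R A r • n ∈ W}
      add_mem' := fun ha hb n => by rw [map_add, add_smul]; exact W.add_mem (ha n) (hb n)
      zero_mem' := fun n => by rw [map_zero, zero_smul]; exact W.zero_mem
      smul_mem' := fun c a ha n => by
        rw [smul_eq_mul, map_mul, mul_smul]; exact W.smul_mem _ (ha n) }
  have hle : Ideal.span S ⊔ J ≤ I := sup_le (Ideal.span_le.mpr hS) hJ
  exact hle hr n

end

/-! ### The bound near a prime -/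

namespace KeyLemma

/-- Let `x` and `y` be families in `Q` such that, locally at `Q`, the `k`-th powers of the elements of `Z`
lie in `(x) + Ann M`, and `y` and `Z` generate `Q`. Then
`ℓ (M_Q / Q^[n] M_Q) ≤ ℓ (M_Q / (xⁿ, yⁿ) M_Q) ≤ n ^ (#x + #y) * ℓ (M_Q / (x, y) M_Q)`, and
`ℓ (M_Q / (x, y) M_Q) ≤ ℓ (M_Q / (Zᵏ, y) M_Q) ≤ k ^ #Z * ℓ (M_Q / Q M_Q)`. -/
theorem bracketLength_le_mul {R : Type u} [CommRing R] {M : Type v} [AddCommGroup M] [Module R M]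
    {Q : Ideal R} [Q.IsPrime] {ι κ : Type*} {s : Finset ι} {x : ι → R} (hx : ∀ i ∈ s, x i ∈ Q)
    {s' : Finset κ} {y : κ → R} (hy : ∀ i ∈ s', y i ∈ Q) {Z : Finset R} {k : ℕ}
    (hZ : ∀ z ∈ Z, ∃ t ∉ Q, t * z ^ k ∈ Ideal.span (x '' s) ⊔ Module.annihilator R M)
    (hQ : ∀ a ∈ Q, ∃ t ∉ Q, t * a ∈ Ideal.span (y '' s') ⊔ Ideal.span Z)
    {m : ℕ} {g : Fin m → M} (hg : Submodule.span R (Set.range g) = ⊤) (n : ℕ) :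
    bracketLength M Q n ≤ (n ^ s.card * (n ^ s'.card * (k ^ Z.card * m)) : ℕ) := by
  set A := Localization.AtPrime Q
  set N := LocalizedAt M Q
  set φ := algebraMap R A
  have hunit {t : R} (ht : t ∉ Q) : IsUnit (φ t) :=
    IsLocalization.map_units A (⟨t, ht⟩ : Q.primeCompl)
  -- The submodules of `N` generated by the `l`-th powers of the members of `x`, `y` and `Z`.
  let X (l : ℕ) : Submodule A N := ⨆ i ∈ s, φ (x i) ^ l • (⊤ : Submodule A N)
  let Y (l : ℕ) : Submodule A N := ⨆ i ∈ s', φ (y i) ^ l • (⊤ : Submodule A N)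
  let Z' (l : ℕ) : Submodule A N := ⨆ i ∈ Z, φ i ^ l • (⊤ : Submodule A N)
  have hX1 : X 1 = ⨆ i ∈ s, φ (x i) • (⊤ : Submodule A N) := by simp only [X, pow_one]
  have hY1 : Y 1 = ⨆ i ∈ s', φ (y i) • (⊤ : Submodule A N) := by simp only [Y, pow_one]
  have hZ1 : Z' 1 = ⨆ i ∈ Z, φ i • (⊤ : Submodule A N) := by simp only [Z', pow_one]
  have h1 : bracketLength M Q n ≤ Module.length A (N ⧸ (X n ⊔ Y n)) := by
    refine Submodule.length_quotient_anti (sup_le ?_ ?_)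
    · refine (Submodule.iSup_smul_top_le_iff _ _ _).mpr fun i hi b => ?_
      rw [← map_pow]
      exact Submodule.smul_mem_smul (Ideal.mem_map_of_mem _ (Ideal.subset_span ⟨_, hx i hi, rfl⟩))
        trivial
    · refine (Submodule.iSup_smul_top_le_iff _ _ _).mpr fun i hi b => ?_
      rw [← map_pow]
      exact Submodule.smul_mem_smul (Ideal.mem_map_of_mem _ (Ideal.subset_span ⟨_, hy i hi, rfl⟩))
        trivial
  have h2 : Module.length A (N ⧸ (X n ⊔ Y n)) ≤
      (n ^ s.card : ℕ) * Module.length A (N ⧸ (X 1 ⊔ Y n)) := by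
    rw [hX1]
    exact Submodule.length_quotient_iSup_pow_smul_top_sup_le _ s _ n
  have h3 : Module.length A (N ⧸ (X 1 ⊔ Y n)) ≤
      (n ^ s'.card : ℕ) * Module.length A (N ⧸ (X 1 ⊔ Y 1)) := by
    rw [sup_comm, sup_comm (X 1), hY1]
    exact Submodule.length_quotient_iSup_pow_smul_top_sup_le _ s' _ n
  have h4 : Module.length A (N ⧸ (X 1 ⊔ Y 1)) ≤ Module.length A (N ⧸ (Z' k ⊔ Y 1)) := by
    refine Submodule.length_quotient_anti (sup_le_sup_right ?_ _)
    refine (Submodule.iSup_smul_top_le_iff _ _ _).mpr fun z hz b => ?_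
    obtain ⟨t, ht, htz⟩ := hZ z hz
    rw [← map_pow]
    refine (X 1).smul_mem_of_mul_mem (fun j hj => (X 1).smul_mem_of_mem_span_sup ?_ ?_ hj)
      (hunit ht) htz b
    · rintro _ ⟨i, hi, rfl⟩
      exact (Submodule.iSup_smul_top_le_iff _ s _).mp hX1.ge i hi
    · intro j hj b
      have hb : j • b = 0 := by
        induction b using LocalizedModule.induction_on with
        | h m t =>
          rw [LocalizedModule.smul'_mk, Module.mem_annihilator.mp hj, LocalizedModule.zero_mk]
      rw [algebraMap_smul, hb]
      exact zero_mem _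
  have h5 : Module.length A (N ⧸ (Z' k ⊔ Y 1)) ≤
      (k ^ Z.card : ℕ) * Module.length A (N ⧸ (Z' 1 ⊔ Y 1)) := by
    rw [hZ1]
    exact Submodule.length_quotient_iSup_pow_smul_top_sup_le _ Z _ k
  have h6 : Module.length A (N ⧸ (Z' 1 ⊔ Y 1)) ≤
      Module.length A (N ⧸ (IsLocalRing.maximalIdeal A • (⊤ : Submodule A N))) := by
    refine Submodule.length_quotient_anti ?_
    have hY (i) (hi : i ∈ s') (b : N) : φ (y i) • b ∈ Z' 1 ⊔ Y 1 :=
      Submodule.mem_sup_right ((Submodule.iSup_smul_top_le_iff _ s' _).mp hY1.ge i hi b)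
    have hZ' (z) (hz : z ∈ Z) (b : N) : φ z • b ∈ Z' 1 ⊔ Y 1 :=
      Submodule.mem_sup_left ((Submodule.iSup_smul_top_le_iff _ Z _).mp hZ1.ge z hz b)
    rw [← Localization.AtPrime.map_eq_maximalIdeal, Ideal.map, Submodule.span_smul_eq,
      Submodule.set_smul_le_iff]
    rintro _ b ⟨a, ha, rfl⟩ -
    obtain ⟨t, ht, hta⟩ := hQ a ha
    rw [← Ideal.span_union, ← sup_bot_eq (Ideal.span _)] at hta
    refine Submodule.smul_mem_of_mul_mem _ (fun j hj =>
      Submodule.smul_mem_of_mem_span_sup _ ?_ ?_ hj) (hunit ht) hta b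
    · rintro _ (⟨i, hi, rfl⟩ | hz)
      · exact hY i hi
      · exact hZ' _ hz
    · rintro _ rfl b
      rw [map_zero, zero_smul]
      exact zero_mem _
  have h7 : Module.length A (N ⧸ (IsLocalRing.maximalIdeal A • (⊤ : Submodule A N))) ≤ m := by
    refine Submodule.length_quotient_maximalIdeal_smul_top_le
      (fun i => LocalizedModule.mkLinearMap Q.primeCompl M (g i)) ?_
    have := span_eq_top_of_isLocalizedModule A Q.primeCompl
      (LocalizedModule.mkLinearMap Q.primeCompl M) hg
    rwa [← Set.range_comp] at this
  push_cast at *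
  refine h1.trans (h2.trans ?_)
  gcongr
  refine h3.trans ?_
  gcongr
  refine h4.trans (h5.trans ?_)
  gcongr
  exact h6.trans h7

theorem bracketLength_eq_zero {R : Type u} [CommRing R] (M : Type v) [AddCommGroup M] [Module R M]
    {Q : Ideal R} [Q.IsPrime] {a : R} (ha : a ∈ Module.annihilator R M) (haQ : a ∉ Q) (n : ℕ) :
    bracketLength M Q n = 0 := by
  have : Subsingleton (LocalizedAt M Q) := LocalizedModule.subsingleton_iff.mpr fun m =>
    ⟨a, haQ, Module.mem_annihilator.mp ha m⟩
  exact Module.length_eq_zero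

/-- The bound on a neighbourhood of `P` in `V(P)`. The constant is `k ^ #Z * m`, where `Z` generates `P`,
the `k`-th powers of the members of `Z` lie in `(x) + Ann M` near `P` for a system of parameters `x` of
`M_P`, and `M` has `m` generators; the exponent `dim M_P + ht (Q / P)` is at most `dim M_Q`. -/
theorem exists_bracketLength_le_of_isOpen_regularLocus {R : Type u} [CommRing R]
    [IsNoetherianRing R] (M : Type v) [AddCommGroup M] [Module R M] [Module.Finite R M]
    (P : Ideal R) [P.IsPrime] (hP : IsOpen (regularLocus (R ⧸ P))) :
    ∃ C : ℕ, ∃ f ∉ P, ∀ (Q : Ideal R) [Q.IsPrime], f ∉ Q → P ≤ Q → ∀ n > 0,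
      bracketLength M Q n ≤
        (C * n ^ moduleDim (Localization.AtPrime Q) (LocalizedAt M Q) : ℕ) := by
  by_cases hann : Module.annihilator R M ≤ P
  swap
  · obtain ⟨a, ha, haP⟩ := SetLike.not_le_iff_exists.mp hann
    refine ⟨0, a, haP, fun Q _ haQ _ n _ => ?_⟩
    rw [bracketLength_eq_zero M ha haQ]
    exact zero_le
  obtain ⟨P', _, s, hP'P, hs, hmin⟩ := Ideal.exists_finset_mem_minimalPrimes_comap_quotient hann
  obtain ⟨Z, hZ⟩ : P.FG := IsNoetherian.noetherian P
  obtain ⟨k, f₁, hf₁, hf₁Z⟩ := Ideal.exists_mul_pow_mem_of_mem_minimalPrimes hmin Z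
    fun z hz => hZ ▸ Ideal.subset_span hz
  obtain ⟨m, g, hg⟩ := Module.Finite.exists_fin (R := R) (M := M)
  -- The regular locus of `R / P` is open and contains the generic point, so it contains some `D(f₂)`.
  obtain ⟨_, ⟨f₂, rfl⟩, hf₂, hf₂P⟩ :=
    PrimeSpectrum.isTopologicalBasis_basic_opens.exists_subset_of_mem_open
      (a := (⟨⊥, Ideal.isPrime_bot⟩ : PrimeSpectrum (R ⧸ P)))
      IsRegularLocalRing.localization_atPrime_bot hP
  obtain ⟨f₂, rfl⟩ := Ideal.Quotient.mk_surjective f₂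
  refine ⟨k ^ Z.card * m, f₁ * f₂, fun h => ?_, fun Q _ hfQ hPQ n hn => ?_⟩
  · refine (‹P.IsPrime›.mem_or_mem h).elim hf₁ fun h => hf₂ ?_
    exact Ideal.Quotient.eq_zero_iff_mem.mpr h
  have hQ' := Ideal.isPrime_map_quotientMk_of_isPrime hPQ
  have hc : (Q.map (Ideal.Quotient.mk P)).comap (Ideal.Quotient.mk P) = Q := by
    rw [Ideal.comap_map_of_surjective' _ Ideal.Quotient.mk_surjective, Ideal.mk_ker,
      sup_eq_left.mpr hPQ]
  have hreg : IsRegularLocalRing (Localization.AtPrime (Q.map (Ideal.Quotient.mk P))) := by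
    refine @hf₂P ⟨Q.map (Ideal.Quotient.mk P), hQ'⟩ fun h => hfQ ?_
    refine Q.mul_mem_left _ ?_
    rw [← hc]
    exact h
  obtain ⟨s', y, hs', hy, hQ⟩ :=
    IsRegularLocalRing.exists_finset_forall_mul_mem_span_sup _ hc
  have hmk (i : R ⧸ Module.annihilator R M) : Ideal.Quotient.mk _ (Quotient.out i) = i :=
    Quotient.out_eq i
  have hx : (Ideal.span (s : Set (R ⧸ Module.annihilator R M))).comap (Ideal.Quotient.mk _) =
      Ideal.span (Quotient.out '' (s : Set (R ⧸ Module.annihilator R M))) ⊔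
        Module.annihilator R M := by
    have h := Ideal.comap_map_of_surjective' (Ideal.Quotient.mk (Module.annihilator R M))
      Ideal.Quotient.mk_surjective
      (Ideal.span (Quotient.out '' (s : Set (R ⧸ Module.annihilator R M))))
    rw [Ideal.mk_ker, Ideal.map_span, Set.image_image] at h
    simpa [hmk] using h
  have hdim : s.card + s'.card ≤ moduleDim (Localization.AtPrime Q) (LocalizedAt M Q) := by
    have : Nontrivial (LocalizedAt M Q) := by
      change (⟨Q, inferInstance⟩ : PrimeSpectrum R) ∈ Module.support R M
      rw [Module.support_eq_zeroLocus]
      exact hann.trans hPQ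
    have := Ideal.height_quotient_add_height_quotient_le_supportDim M P Q hPQ P' hP'P _ hc
    rw [← coe_moduleDim, ← hs, ← hs'] at this
    exact_mod_cast this
  have hle := bracketLength_le_mul (M := M) (Q := Q) (s := s) (x := Quotient.out) (s' := s') (y := y)
    (Z := Z) (k := k) (fun i hi => hPQ ?_) hy
    (fun z hz => ⟨f₁, fun h => hfQ (Q.mul_mem_right _ h), hx ▸ hf₁Z z hz⟩) (by rwa [hZ]) hg n
  · refine hle.trans (Nat.cast_le.mpr ?_)
    rw [← mul_assoc, ← pow_add, mul_comm]
    gcongr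
  · refine hmin.1.2 ?_
    rw [Ideal.mem_comap, hmk]
    exact Ideal.subset_span hi

end KeyLemma

end

/-! ### The uniform bound -/

theorem mainTheorem5 {R : Type u} [CommRing R] (hR : KeyLemma.IsExcellentRing R)
    (p : ℕ) (hp : p.Prime) [CharP R p]
    (M : Type v) [AddCommGroup M] [Module R M] [Module.Finite R M] :
    ∃ C : ℕ, ∀ (P : Ideal R) [P.IsPrime], ∃ s : R, s ∉ P ∧
      ∀ (Q : Ideal R) [Q.IsPrime], s ∉ Q → P ≤ Q → ∀ e : ℕ,
        KeyLemma.bracketLength M Q (p ^ e) ≤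
          ((C * (p ^ e) ^ KeyLemma.moduleDim (Localization.AtPrime Q)
            (KeyLemma.LocalizedAt M Q) : ℕ) : ℕ∞) := by
  have := hR.isNoetherianRing
  -- Noetherian induction on the closed set `V(I)`.
  have key (I : Ideal R) : ∃ C : ℕ, ∀ (Q : Ideal R) [Q.IsPrime], I ≤ Q → ∀ n > 0,
      KeyLemma.bracketLength M Q n ≤ ((C * n ^ KeyLemma.moduleDim (Localization.AtPrime Q)
        (KeyLemma.LocalizedAt M Q) : ℕ) : ℕ∞) := by
    induction I using WellFoundedGT.induction with | ind I ih
    have hmono {C C' : ℕ} (h : C ≤ C') (a : ℕ) : ((C * a : ℕ) : ℕ∞) ≤ (C' * a : ℕ) := by gcongr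
    by_cases hI : I.IsPrime
    · obtain ⟨C, f, hf, hC⟩ := KeyLemma.exists_bracketLength_le_of_isOpen_regularLocus M I
        (hR.isJ2Ring.isOpen_regularLocus (R ⧸ I))
      obtain ⟨C', hC'⟩ := ih (I ⊔ Ideal.span {f}) (by simpa using hf)
      refine ⟨max C C', fun Q _ hIQ n hn => ?_⟩
      by_cases hfQ : f ∈ Q
      · exact (hC' Q (sup_le hIQ (by simpa using hfQ)) n hn).trans (hmono (le_max_right _ _) _)
      · exact (hC Q hfQ hIQ n hn).trans (hmono (le_max_left _ _) _)
    · by_cases htop : I = ⊤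
      · exact ⟨0, fun Q hQ hIQ => absurd (top_le_iff.mp (htop ▸ hIQ)) hQ.ne_top⟩
      obtain ⟨a, ha, b, hb, hab⟩ := (Ideal.not_isPrime_iff.mp hI).resolve_left htop
      obtain ⟨C, hC⟩ := ih (I ⊔ Ideal.span {a}) (by simpa using ha)
      obtain ⟨C', hC'⟩ := ih (I ⊔ Ideal.span {b}) (by simpa using hb)
      refine ⟨max C C', fun Q hQ hIQ n hn => ?_⟩
      rcases hQ.mem_or_mem (hIQ hab) with h | h
      · exact (hC Q (sup_le hIQ (by simpa using h)) n hn).trans (hmono (le_max_left _ _) _)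
      · exact (hC' Q (sup_le hIQ (by simpa using h)) n hn).trans (hmono (le_max_right _ _) _)
  -- The constant for `V(⊥) = Spec R` works at every prime, so `s = 1` will do.
  obtain ⟨C, hC⟩ := key ⊥
  exact ⟨C, fun P hP => ⟨1, P.ne_top_iff_one.mp hP.ne_top, fun Q _ _ _ e =>
    hC Q bot_le _ (pow_pos hp.pos e)⟩⟩
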